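/- **Theorem (Pick's interpolation theorem).** Let $H^\infty$ be the algebra of bounded analytic functions on the open unit disc $\mathbb{D}=\{z\in\mathbb{C}:|z|<1\}$, with norm $\|f\|_\infty=\sup_{z\in\mathbb{D}}|f(z)|$. Given points $z_1,\ldots,z_n\in\mathbb{D}$ and $w_1,\ldots,w_n\in\mathbb{C}$, there exists a function $f\in H^\infty$ with $f(z_i)=w_i$ for all $i=1,\ldots,n$ and $\|f\|_\infty\leq 1$ if and only if the matrix $$\left(\frac{1-w_i\overline{w_j}}{1-z_i\overline{z_j}}\right)_{i,j=1}^n$$ is positive semidefinite. -/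

import Mathlib

open scoped ComplexOrder ComplexConjugate

/-- `H^∞`: the bounded analytic functions on the open unit disc. A function on the disc is
represented by any function `ℂ → ℂ` extending it; values outside the disc play no role. -/
def HInfty : Set (ℂ → ℂ) :=
  {f | AnalyticOnNhd ℂ f (Metric.ball 0 1) ∧ Bornology.IsBounded (f '' Metric.ball 0 1)}

/-- The norm `‖f‖_∞ = sup_{|z| < 1} |f z|` of a function `f` in `HInfty` (the supremum is finite
for such `f`). -/
noncomputable def hInftyNorm (f : ℂ → ℂ) : ℝ :=
  ⨆ z : Metric.ball (0 : ℂ) 1, ‖f z‖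

/-- The Pick matrix with entries `(1 - w_i * conj w_j) / (1 - z_i * conj z_j)`. -/
noncomputable def pickMatrix {n : ℕ} (z w : Fin n → ℂ) : Matrix (Fin n) (Fin n) ℂ :=
  Matrix.of fun i j => (1 - w i * conj (w j)) / (1 - z i * conj (z j))

open Metric Set

/-! Schur's algorithm, by induction on the number of distinct nodes. If `‖w 0‖ < 1`, a disc
automorphism moves the value at `z 0` to `0`, and dividing by the Blaschke factor at `z 0` leaves a
problem with one node fewer. The Schwarz lemma keeps the bound, and the step is reversible
(`exists_schur_step`, `exists_inverse_schur_step`). On the matrix side the same step is the Schur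
complement of the corner entry, up to congruence (`posSemidef_pickMatrix_iff_schur_step`). If `‖w 0‖
= 1`, either side forces constant data. Repeated nodes are harmless because positivity forces equal
values there (`eq_of_posSemidef_of_eq`). -/

/-- A function in the closed unit ball of `H^∞`. -/
structure IsSchurFunction (f : ℂ → ℂ) : Prop where
  differentiableOn : DifferentiableOn ℂ f (ball 0 1)
  norm_le_one : ∀ z : ℂ, ‖z‖ < 1 → ‖f z‖ ≤ 1

theorem isSchurFunction_iff (f : ℂ → ℂ) :
    IsSchurFunction f ↔ f ∈ HInfty ∧ hInftyNorm f ≤ 1 := by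
  constructor
  · rintro ⟨hd, hb⟩
    refine ⟨⟨(Complex.analyticOnNhd_iff_differentiableOn isOpen_ball).2 hd, ?_⟩, ?_⟩
    · refine (isBounded_iff_forall_norm_le).2 ⟨1, ?_⟩
      rintro _ ⟨z, hz, rfl⟩
      exact hb z (by simpa using hz)
    · have : Nonempty (ball (0 : ℂ) 1) := ⟨⟨0, by simp⟩⟩
      exact ciSup_le fun z => hb z (mem_ball_zero_iff.1 z.2)
  · rintro ⟨⟨ha, hb⟩, hn⟩
    refine ⟨ha.differentiableOn, fun z hz => le_trans ?_ hn⟩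
    obtain ⟨C, hC⟩ := isBounded_iff_forall_norm_le.1 hb
    refine le_ciSup (f := fun z : ball (0 : ℂ) 1 => ‖f z‖) ⟨C, ?_⟩ ⟨z, by simpa using hz⟩
    rintro _ ⟨y, rfl⟩
    exact hC _ ⟨y, y.2, rfl⟩

/-- The Möbius automorphism of the disc taking `a` to `0`. -/
noncomputable def discMoebius (a z : ℂ) : ℂ := (z - a) / (1 - conj a * z)

theorem one_sub_conj_mul_ne_zero {a z : ℂ} (ha : ‖a‖ < 1) (hz : ‖z‖ ≤ 1) :
    1 - conj a * z ≠ 0 := by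
  intro h
  have h1 : ‖conj a * z‖ = 1 := by rw [← sub_eq_zero.1 h, norm_one]
  rw [norm_mul, Complex.norm_conj] at h1
  nlinarith [norm_nonneg a, norm_nonneg z]

/-- The sign of the right side decides whether `discMoebius a` maps into the disc. -/
theorem sq_norm_one_sub_sub_sq_norm_sub (a z : ℂ) :
    ‖1 - conj a * z‖ ^ 2 - ‖z - a‖ ^ 2 = (1 - ‖a‖ ^ 2) * (1 - ‖z‖ ^ 2) := by
  simp only [Complex.sq_norm, Complex.normSq_apply, Complex.sub_re, Complex.sub_im,
    Complex.mul_re, Complex.mul_im, Complex.conj_re, Complex.conj_im, Complex.one_re,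
    Complex.one_im]
  ring

theorem norm_discMoebius_le_one {a z : ℂ} (ha : ‖a‖ < 1) (hz : ‖z‖ ≤ 1) :
    ‖discMoebius a z‖ ≤ 1 := by
  rw [discMoebius, norm_div]
  refine div_le_one_of_le₀ ?_ (norm_nonneg _)
  refine le_of_pow_le_pow_left₀ two_ne_zero (norm_nonneg _) ?_
  have := sq_norm_one_sub_sub_sq_norm_sub a z
  have h1 : 0 ≤ 1 - ‖a‖ ^ 2 := by nlinarith [norm_nonneg a]
  have h2 : 0 ≤ 1 - ‖z‖ ^ 2 := by nlinarith [norm_nonneg z]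
  nlinarith [mul_nonneg h1 h2]

theorem norm_discMoebius_lt_one {a z : ℂ} (ha : ‖a‖ < 1) (hz : ‖z‖ < 1) :
    ‖discMoebius a z‖ < 1 := by
  have h0 := norm_pos_iff.2 (one_sub_conj_mul_ne_zero ha hz.le)
  rw [discMoebius, norm_div, div_lt_one h0]
  refine lt_of_pow_lt_pow_left₀ 2 h0.le ?_
  have := sq_norm_one_sub_sub_sq_norm_sub a z
  have h1 : 0 < 1 - ‖a‖ ^ 2 := by nlinarith [norm_nonneg a]
  have h2 : 0 < 1 - ‖z‖ ^ 2 := by nlinarith [norm_nonneg z]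
  nlinarith [mul_pos h1 h2]

@[simp] theorem discMoebius_self (a : ℂ) : discMoebius a a = 0 := by simp [discMoebius]

theorem discMoebius_neg_discMoebius {a z : ℂ} (ha : ‖a‖ < 1) (hz : ‖z‖ ≤ 1) :
    discMoebius (-a) (discMoebius a z) = z := by
  have h0 := one_sub_conj_mul_ne_zero ha hz
  have h1 := one_sub_conj_mul_ne_zero ha ha.le
  have h2 : 1 - conj (-a) * discMoebius a z = (1 - conj a * a) / (1 - conj a * z) := by
    rw [discMoebius, map_neg]
    field_simp
    ring
  have h3 : discMoebius a z - -a = (1 - conj a * a) * z / (1 - conj a * z) := by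
    rw [discMoebius, sub_neg_eq_add, div_add' _ _ _ h0]
    ring
  rw [discMoebius, h2, h3, div_div_div_cancel_right₀ h0, mul_div_cancel_left₀ _ h1]

theorem discMoebius_ne_zero {a z : ℂ} (ha : ‖a‖ < 1) (hz : ‖z‖ ≤ 1) (h : z ≠ a) :
    discMoebius a z ≠ 0 :=
  div_ne_zero (sub_ne_zero.2 h) (one_sub_conj_mul_ne_zero ha hz)

theorem DifferentiableOn.discMoebius {a : ℂ} {f : ℂ → ℂ} {s : Set ℂ} (ha : ‖a‖ < 1)
    (hf : DifferentiableOn ℂ f s) (hb : ∀ z ∈ s, ‖f z‖ ≤ 1) :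
    DifferentiableOn ℂ (fun z => discMoebius a (f z)) s :=
  (hf.sub_const a).div ((hf.const_mul _).const_sub 1)
    fun z hz => one_sub_conj_mul_ne_zero ha (hb z hz)

namespace IsSchurFunction

theorem const {b : ℂ} (hb : ‖b‖ ≤ 1) : IsSchurFunction fun _ => b :=
  ⟨differentiableOn_const b, fun _ _ => hb⟩

theorem discMoebius {b : ℂ} {f : ℂ → ℂ} (hb : ‖b‖ < 1) (hf : IsSchurFunction f) :
    IsSchurFunction fun z => discMoebius b (f z) :=
  ⟨hf.1.discMoebius hb fun z hz => hf.2 z (by simpa using hz),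
    fun z hz => norm_discMoebius_le_one hb (hf.2 z hz)⟩

theorem comp_discMoebius {a : ℂ} {f : ℂ → ℂ} (ha : ‖a‖ < 1) (hf : IsSchurFunction f) :
    IsSchurFunction fun z => f (_root_.discMoebius a z) :=
  ⟨hf.1.comp (differentiableOn_id.discMoebius ha fun z hz => le_of_lt (by simpa using hz))
    fun z hz => by simpa using norm_discMoebius_lt_one ha (by simpa using hz),
    fun z hz => hf.2 _ (norm_discMoebius_lt_one ha hz)⟩

theorem id : IsSchurFunction fun z => z :=
  ⟨differentiableOn_id, fun _ hz => hz.le⟩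

theorem mul {f g : ℂ → ℂ} (hf : IsSchurFunction f) (hg : IsSchurFunction g) :
    IsSchurFunction fun z => f z * g z :=
  ⟨hf.1.mul hg.1, fun z hz => by
    rw [norm_mul]
    exact mul_le_one₀ (hf.2 z hz) (norm_nonneg _) (hg.2 z hz)⟩

/-- Schwarz lemma. -/
theorem dslope_zero {f : ℂ → ℂ} (hf : IsSchurFunction f) (h0 : f 0 = 0) :
    IsSchurFunction (dslope f 0) := by
  refine ⟨(Complex.differentiableOn_dslope (ball_mem_nhds 0 one_pos)).2 hf.1, fun z hz => ?_⟩
  have := Complex.norm_dslope_le_div_of_mapsTo_ball (R₂ := 1) hf.1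
    (fun z hz => by simpa [h0] using hf.2 z (by simpa using hz)) (by simpa using hz : z ∈ ball 0 1)
  simpa using this

/-- Maximum modulus principle. -/
theorem eq_of_norm_eq_one {f : ℂ → ℂ} (hf : IsSchurFunction f) {a z : ℂ} (ha : ‖a‖ < 1)
    (h : ‖f a‖ = 1) (hz : ‖z‖ < 1) : f z = f a :=
  Complex.eqOn_of_isPreconnected_of_isMaxOn_norm (convex_ball 0 1).isPreconnected isOpen_ball
    hf.1 (by simpa using ha : a ∈ ball 0 1)
    (fun y hy => by simpa [h] using hf.2 y (by simpa using hy)) (by simpa using hz)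

/-- The Schur step: dividing out a zero after moving the value `f a` to `0`. -/
theorem exists_schur_step {f : ℂ → ℂ} (hf : IsSchurFunction f) {a : ℂ} (ha : ‖a‖ < 1)
    (hb : ‖f a‖ < 1) : ∃ g, IsSchurFunction g ∧ ∀ z, ‖z‖ < 1 → z ≠ a →
      g z = _root_.discMoebius (f a) (f z) / _root_.discMoebius a z := by
  have ha' : ‖-a‖ < 1 := by simpa using ha
  -- `discMoebius (-a)` inverts `discMoebius a`, so the node `a` becomes the origin, where the
  -- Schwarz lemma applies.
  set F : ℂ → ℂ := fun z => _root_.discMoebius (f a) (f (_root_.discMoebius (-a) z)) with hF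
  have hFS : IsSchurFunction F := (hf.comp_discMoebius ha').discMoebius hb
  have hF0 : F 0 = 0 := by
    have : _root_.discMoebius (-a) 0 = a := by simp [_root_.discMoebius]
    simp [hF, this]
  refine ⟨_, (hFS.dslope_zero hF0).comp_discMoebius ha, fun z hz hza => ?_⟩
  rw [dslope_of_ne _ (discMoebius_ne_zero ha hz.le hza), slope_def_field, hF0, sub_zero, sub_zero]
  simp only [hF]
  rw [discMoebius_neg_discMoebius ha hz.le]

/-- The inverse Schur step. -/
theorem exists_inverse_schur_step {g : ℂ → ℂ} (hg : IsSchurFunction g) {a b : ℂ} (ha : ‖a‖ < 1)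
    (hb : ‖b‖ < 1) : ∃ f, IsSchurFunction f ∧ f a = b ∧ ∀ z w, ‖z‖ < 1 → ‖w‖ ≤ 1 → z ≠ a →
      g z = _root_.discMoebius b w / _root_.discMoebius a z → f z = w := by
  refine ⟨_, ((IsSchurFunction.id.discMoebius ha).mul hg).discMoebius
    (b := -b) (by simpa using hb), ?_, fun z w hz hw hza h => ?_⟩
  · simp [_root_.discMoebius]
  · simp only [h]
    rw [mul_div_cancel₀ _ (discMoebius_ne_zero ha hz.le hza), discMoebius_neg_discMoebius hb hw]

end IsSchurFunction

/-! ### Positive semidefinite matrices and Pick matrices -/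

theorem Matrix.PosSemidef.mul_apply_le {ι : Type*} {M : Matrix ι ι ℂ} (hM : M.PosSemidef)
    (i j : ι) : 0 ≤ M i i * M j j - M i j * conj (M i j) := by
  have h := (hM.submatrix ![i, j]).det_nonneg
  rw [Matrix.det_fin_two] at h
  simpa [← hM.1.apply j i] using h

theorem Matrix.IsHermitian.posSemidef_iff_schur_zero {n : ℕ}
    {M : Matrix (Fin (n + 1)) (Fin (n + 1)) ℂ} (hM : M.IsHermitian) (h0 : 0 < M 0 0) :
    M.PosSemidef ↔ (Matrix.of fun i j : Fin n =>
      M i.succ j.succ - M i.succ 0 * M 0 j.succ / M 0 0).PosSemidef := by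
  let e : Unit ⊕ Fin n ≃ Fin (n + 1) :=
    ((Equiv.sumComm _ _).trans (Equiv.optionEquivSumPUnit _).symm).trans (finSuccEquiv n).symm
  have hA : (Matrix.diagonal fun _ : Unit => M 0 0).PosDef := Matrix.PosDef.diagonal fun _ => h0
  have := hA.isUnit.invertible
  rw [← Matrix.posSemidef_submatrix_equiv e]
  have h1 : M.submatrix e e = Matrix.fromBlocks (Matrix.diagonal fun _ : Unit => M 0 0)
      (Matrix.of fun _ j => M 0 (Fin.succ j)) (Matrix.of fun _ j => M 0 (Fin.succ j)).conjTranspose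
      (Matrix.of fun i j => M (Fin.succ i) (Fin.succ j)) := by
    ext i j
    rcases i with i | i <;> rcases j with j | j <;> simp [e, hM.apply]
  rw [h1, Matrix.PosDef.fromBlocks₁₁ _ _ hA]
  refine iff_of_eq (congrArg _ ?_)
  ext i j
  simp [Matrix.mul_apply, hM.apply]
  ring

theorem posSemidef_of_mul_mul_conj_iff {ι : Type*} [Finite ι] {M : Matrix ι ι ℂ} {d : ι → ℂ}
    (hd : ∀ i, d i ≠ 0) :
    (Matrix.of fun i j => d i * M i j * conj (d j)).PosSemidef ↔ M.PosSemidef := by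
  classical
  have := Fintype.ofFinite ι
  have hU : IsUnit (Matrix.diagonal d) := by
    rw [Matrix.isUnit_iff_isUnit_det, Matrix.det_diagonal, isUnit_iff_ne_zero]
    exact Finset.prod_ne_zero_iff.2 fun i _ => hd i
  refine Iff.trans (iff_of_eq (congrArg _ ?_))
    (Matrix.IsUnit.posSemidef_star_right_conjugate_iff hU)
  ext i j
  simp [Matrix.star_eq_conjTranspose, Matrix.diagonal_conjTranspose, Matrix.diagonal_mul,
    Matrix.mul_diagonal]

theorem posSemidef_of_smul_iff {ι : Type*} {M : Matrix ι ι ℂ} {c : ℝ} (hc : 0 < c) :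
    (c • M).PosSemidef ↔ M.PosSemidef :=
  ⟨fun h => by simpa [smul_smul, hc.ne'] using h.smul (inv_nonneg.2 hc.le), fun h => h.smul hc.le⟩

theorem isHermitian_pickMatrix {n : ℕ} (z w : Fin n → ℂ) : (pickMatrix z w).IsHermitian := by
  ext i j
  simp [pickMatrix, mul_comm]

theorem one_sub_mul_conj_self (b : ℂ) : 1 - b * conj b = ((1 - ‖b‖ ^ 2 : ℝ) : ℂ) := by
  rw [Complex.mul_conj, Complex.normSq_eq_norm_sq]
  push_cast
  rfl

theorem pickMatrix_apply_self {n : ℕ} (z w : Fin n → ℂ) (i : Fin n) :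
    pickMatrix z w i i = (((1 - ‖w i‖ ^ 2) / (1 - ‖z i‖ ^ 2) : ℝ) : ℂ) := by
  rw [pickMatrix, Matrix.of_apply, one_sub_mul_conj_self, one_sub_mul_conj_self]
  push_cast
  rfl

theorem norm_le_one_of_posSemidef {n : ℕ} {z w : Fin n → ℂ} (hz : ∀ i, ‖z i‖ < 1)
    (h : (pickMatrix z w).PosSemidef) (i : Fin n) : ‖w i‖ ≤ 1 := by
  have h1 := h.diag_nonneg (i := i)
  rw [pickMatrix_apply_self, Complex.zero_le_real] at h1
  have h2 : 0 < 1 - ‖z i‖ ^ 2 := by nlinarith [hz i, norm_nonneg (z i)]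
  have h3 : 0 ≤ 1 - ‖w i‖ ^ 2 := by
    by_contra! h4
    exact absurd h1 (not_le.2 (div_neg_of_neg_of_pos h4 h2))
  nlinarith [norm_nonneg (w i)]

/-- Conjugates become independent variables, which makes this a purely rational identity. -/
theorem schur_step_identity {K : Type*} [Field K] {a a' b b' x y' u v' : K}
    (h1 : 1 - a * a' ≠ 0) (h2 : 1 - x * y' ≠ 0) (h3 : 1 - x * a' ≠ 0) (h4 : 1 - a * y' ≠ 0)
    (h5 : 1 - b * b' ≠ 0) (h6 : 1 - u * b' ≠ 0) (h7 : 1 - b * v' ≠ 0)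
    (h8 : x - a ≠ 0) (h9 : y' - a' ≠ 0) :
    (1 - u * v') / (1 - x * y') - (1 - u * b') / (1 - x * a') * ((1 - b * v') / (1 - a * y')) /
        ((1 - b * b') / (1 - a * a')) =
      (1 - b * b')⁻¹ * ((1 - u * b') * ((x - a) / (1 - x * a')) *
        ((1 - (u - b) / (1 - u * b') / ((x - a) / (1 - x * a')) *
          ((v' - b') / (1 - b * v') / ((y' - a') / (1 - a * y')))) / (1 - x * y')) *
        ((1 - b * v') * ((y' - a') / (1 - a * y')))) := by
  -- Denominators become atoms, so that `field_simp` clears them without expanding.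
  generalize e1 : 1 - a * a' = d1 at *
  generalize e2 : 1 - x * y' = d2 at *
  generalize e3 : 1 - x * a' = d3 at *
  generalize e4 : 1 - a * y' = d4 at *
  generalize e5 : 1 - b * b' = d5 at *
  generalize e6 : 1 - u * b' = d6 at *
  generalize e7 : 1 - b * v' = d7 at *
  field_simp
  subst e1 e2 e3 e4 e5 e6 e7
  ring

/-- The Schur complement of the corner of a Pick matrix is congruent to the Pick matrix of the
data transformed by the Schur step. -/
theorem posSemidef_pickMatrix_iff_schur_step {n : ℕ} {z w : Fin (n + 1) → ℂ}
    (hz : ∀ i, ‖z i‖ < 1) (hinj : Function.Injective z) (hw : ∀ i, ‖w i‖ ≤ 1) (h0 : ‖w 0‖ < 1) :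
    (pickMatrix z w).PosSemidef ↔ (pickMatrix (fun i : Fin n => z i.succ) fun i =>
      discMoebius (w 0) (w i.succ) / discMoebius (z 0) (z i.succ)).PosSemidef := by
  have ha : 0 < 1 - ‖z 0‖ ^ 2 := by nlinarith [hz 0, norm_nonneg (z 0)]
  have hb : 0 < 1 - ‖w 0‖ ^ 2 := by nlinarith [norm_nonneg (w 0)]
  rw [(isHermitian_pickMatrix z w).posSemidef_iff_schur_zero
    (by rw [pickMatrix_apply_self, Complex.zero_lt_real]; positivity)]
  have hne : ∀ i : Fin n, z i.succ ≠ z 0 := fun i h => Fin.succ_ne_zero i (hinj h)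
  -- The congruence factors come from `1 - φ(u) * conj (φ(v)) = (1 - ‖b‖ ^ 2) * (1 - u * conj v) /
  -- ((1 - u * conj b) * (1 - b * conj v))` for `φ = discMoebius b`, `b = w 0`.
  have hd : ∀ i : Fin n,
      (1 - conj (w 0) * w i.succ) * discMoebius (z 0) (z i.succ) ≠ 0 := fun i =>
    mul_ne_zero (one_sub_conj_mul_ne_zero h0 (hw _)) (discMoebius_ne_zero (hz 0) (hz _).le (hne i))
  refine Iff.trans (iff_of_eq (congrArg _ ?_))
    ((posSemidef_of_smul_iff (inv_pos.2 hb)).trans (posSemidef_of_mul_mul_conj_iff hd))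
  ext i j
  have hcz : ∀ k : Fin n, conj (z k.succ) - conj (z 0) ≠ 0 := fun k => by
    rw [← map_sub]
    exact (map_ne_zero _).2 (sub_ne_zero.2 (hne k))
  have hden : ∀ k l, 1 - z k * conj (z l) ≠ 0 := fun k l => by
    rw [mul_comm]
    exact one_sub_conj_mul_ne_zero (hz l) (hz k).le
  have hden' : ∀ k, 1 - w k * conj (w 0) ≠ 0 := fun k => by
    rw [mul_comm]
    exact one_sub_conj_mul_ne_zero h0 (hw k)
  have hden'' : ∀ k, 1 - w 0 * conj (w k) ≠ 0 := fun k => by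
    simpa [mul_comm] using (map_ne_zero conj).2 (hden' k)
  simp only [pickMatrix, discMoebius, Matrix.of_apply, Matrix.smul_apply, Complex.real_smul,
    Complex.ofReal_inv, ← one_sub_mul_conj_self, map_mul, map_div₀, map_sub, map_one,
    Complex.conj_conj, mul_comm (conj _) (z _), mul_comm (conj _) (w _)]
  exact schur_step_identity (hden _ _) (hden _ _) (hden _ _) (hden _ _) (hden' _) (hden' _)
    (hden'' _) (sub_ne_zero.2 (hne i)) (hcz j)

/-! ### Interpolation at distinct and repeated nodes -/

theorem exists_schurFunction_iff_posSemidef {n : ℕ} {z w : Fin n → ℂ} (hz : ∀ i, ‖z i‖ < 1)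
    (hinj : Function.Injective z) :
    (∃ f, IsSchurFunction f ∧ ∀ i, f (z i) = w i) ↔ (pickMatrix z w).PosSemidef := by
  induction n with
  | zero =>
    refine iff_of_true ⟨_, IsSchurFunction.id, fun i => i.elim0⟩ ?_
    rw [Subsingleton.elim (pickMatrix z w) 0]
    exact Matrix.PosSemidef.zero
  | succ n ih =>
    by_cases hw : ∀ i, ‖w i‖ ≤ 1
    swap
    · refine iff_of_false ?_ fun h => hw (norm_le_one_of_posSemidef hz h)
      rintro ⟨f, hf, hfw⟩
      exact hw fun i => hfw i ▸ hf.2 _ (hz i)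
    rcases (hw 0).lt_or_eq with h0 | h0
    · rw [posSemidef_pickMatrix_iff_schur_step hz hinj hw h0,
        ← ih (fun i => hz i.succ) (hinj.comp (Fin.succ_injective n))]
      have hne : ∀ i : Fin n, z i.succ ≠ z 0 := fun i h => Fin.succ_ne_zero i (hinj h)
      constructor
      · rintro ⟨f, hf, hfw⟩
        obtain ⟨g, hg, h⟩ := hf.exists_schur_step (hz 0) (by rwa [hfw 0])
        exact ⟨g, hg, fun i => by rw [h _ (hz _) (hne i), hfw, hfw]⟩
      · rintro ⟨g, hg, hgw⟩
        obtain ⟨f, hf, hf0, h⟩ := hg.exists_inverse_schur_step (hz 0) h0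
        exact ⟨f, hf, Fin.cases hf0 fun i => h _ _ (hz _) (hw _) (hne i) (hgw i)⟩
    · have hww : w 0 * conj (w 0) = 1 := by
        rw [Complex.mul_conj, Complex.normSq_eq_norm_sq, h0]; simp
      have key : (∀ i, w i = w 0) → (∃ f, IsSchurFunction f ∧ ∀ i, f (z i) = w i) ∧
          (pickMatrix z w).PosSemidef := fun h => by
        refine ⟨⟨_, IsSchurFunction.const (hw 0), fun i => (h i).symm⟩, ?_⟩
        have : pickMatrix z w = 0 := by
          ext i j
          simp [pickMatrix, h i, h j, hww]
        rw [this]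
        exact Matrix.PosSemidef.zero
      constructor
      · rintro ⟨f, hf, hfw⟩
        refine (key fun i => ?_).2
        rw [← hfw, ← hfw, hf.eq_of_norm_eq_one (hz 0) (by rw [hfw, h0]) (hz i)]
      · intro h
        refine (key fun i => ?_).1
        -- The diagonal entry at `0` vanishes, so this minor is minus a square and the entry `(i,
        -- 0)` vanishes too.
        have h1 := h.mul_apply_le i 0
        rw [pickMatrix_apply_self z w 0, h0, Complex.mul_conj] at h1
        have h2 : pickMatrix z w i 0 = 0 := by
          rw [← Complex.normSq_eq_zero]
          refine le_antisymm ?_ (Complex.normSq_nonneg _)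
          simpa [← Complex.ofReal_neg] using h1
        rw [pickMatrix, Matrix.of_apply, div_eq_zero_iff] at h2
        have h3 : 1 - z i * conj (z 0) ≠ 0 := by
          rw [mul_comm]
          exact one_sub_conj_mul_ne_zero (hz 0) (hz i).le
        have h4 := sub_eq_zero.1 (h2.resolve_right h3)
        linear_combination (-w 0) * h4 - w i * hww

/-- With equal nodes the 2×2 minor is a nonpositive multiple of `‖w i - w j‖ ^ 2`. -/
theorem eq_of_posSemidef_of_eq {n : ℕ} {z w : Fin n → ℂ} (hz : ∀ i, ‖z i‖ < 1)
    (h : (pickMatrix z w).PosSemidef) {i j : Fin n} (hij : z i = z j) : w i = w j := by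
  have h1 := h.mul_apply_le i j
  have hpos : 0 < 1 - ‖z j‖ ^ 2 := by nlinarith [hz j, norm_nonneg (z j)]
  have h2 : pickMatrix z w i i * pickMatrix z w j j - pickMatrix z w i j * conj (pickMatrix z w i j)
      = ((-(‖w i - w j‖ ^ 2 / (1 - ‖z j‖ ^ 2) ^ 2) : ℝ) : ℂ) := by
    simp only [pickMatrix, Matrix.of_apply, hij, one_sub_mul_conj_self (z j), map_div₀, map_sub,
      map_one, map_mul, Complex.conj_conj, Complex.conj_ofReal]
    have : ((1 - ‖z j‖ ^ 2 : ℝ) : ℂ) ≠ 0 := by exact_mod_cast hpos.ne'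
    rw [← Complex.normSq_eq_norm_sq (w i - w j), Complex.ofReal_neg, Complex.ofReal_div,
      ← Complex.mul_conj, Complex.ofReal_pow]
    field_simp
    simp
    ring
  rw [h2, Complex.zero_le_real] at h1
  have h3 : ‖w i - w j‖ ^ 2 / (1 - ‖z j‖ ^ 2) ^ 2 = 0 :=
    le_antisymm (by linarith) (by positivity)
  simpa [hpos.ne', sub_eq_zero] using h3

theorem mainTheorem9 (n : ℕ) (z w : Fin n → ℂ) (hz : ∀ i, z i ∈ Metric.ball (0 : ℂ) 1) :
    (∃ f ∈ HInfty, (∀ i, f (z i) = w i) ∧ hInftyNorm f ≤ 1) ↔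
      (pickMatrix z w).PosSemidef := by
  have hz' : ∀ i, ‖z i‖ < 1 := fun i => by simpa using hz i
  trans ∃ f, IsSchurFunction f ∧ ∀ i, f (z i) = w i
  · simp only [isSchurFunction_iff]
    exact exists_congr fun f => by tauto
  -- Choose one index for each distinct node.
  obtain ⟨m, ⟨e⟩⟩ := Finite.exists_equiv_fin (range z)
  let r : Fin n → Fin m := fun i => e ⟨z i, mem_range_self i⟩
  choose s hs using fun k : Fin m => (e.symm k).2
  have hzs : ∀ i, z (s (r i)) = z i := fun i => by simp [hs, r]
  have hinj : Function.Injective (z ∘ s) := fun k l h => by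
    simp only [Function.comp_apply, hs] at h
    exact e.symm.injective (Subtype.ext h)
  have hiff := exists_schurFunction_iff_posSemidef (w := w ∘ s) (fun k => hz' (s k)) hinj
  constructor
  · rintro ⟨f, hf, hfw⟩
    -- Positivity survives non-injective reindexing, so repeating rows and columns along `r` is
    -- allowed.
    have h := (hiff.1 ⟨f, hf, fun k => hfw (s k)⟩).submatrix r
    convert h using 1
    ext i j
    simp [pickMatrix, ← hfw, hzs]
  · intro h
    obtain ⟨f, hf, hfw⟩ := hiff.2 (h.submatrix s)
    refine ⟨f, hf, fun i => ?_⟩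
    rw [← hzs i]
    exact (hfw (r i)).trans (eq_of_posSemidef_of_eq hz' h (hzs i))
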